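/- Let $R$ be a commutative ring and let $n,k\ge 0$ be integers. Let $H$ be the abelian group generated by $x_1,\dots,x_{n+1},v_1,\dots,v_k$ with the single relation $x_1+\dots+x_{n+1}=v_1+\dots+v_k$ (the first homology of a sphere with $n+k+1$ punctures), and for $0\le i\le n+1$, $0\le j\le k$ put $$c_{ij}=v_k+v_{k-1}+\dots+v_{j+1}-x_1-x_2-\dots-x_i\in H .$$ For every nonincreasing function $\phi:[1,n]\to[1,k]$ let $$S_\phi=\{v_j \mid j\notin \mathrm{im}(\phi)\}\cup\{x_{i+1}\mid \phi(i)=\phi(i+1)\}\cup\{-c_{i,\phi(i)}\mid i=1\text{ or }\phi(i-1)>\phi(i)\}\cup\{c_{i,\phi(i)-1}\mid i=n\text{ or }\phi(i+1)<\phi(i)\},$$ a basis of $H$, and let $\sigma_\phi\subset \mathrm{Hom}(H,\mathbb{R})$ be the cone dual to the cone generated by $S_\phi$. Let $\mathcal{Y}_{n,k}$ be the toric scheme over $R$ obtained by gluing the affine charts $\mathcal{U}_\phi=\mathrm{Spec}\,R[\sigma_\phi^\vee\cap H]$ (each an affine space with coordinates the monomials of weights in $S_\phi$) and the torus $\mathrm{Spec}\,R[H]$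 (the chart of the zero cone) along the open subschemes that correspond to common faces of the cones. The weights $v_j$ and $x_i$ lie in all $\sigma_\phi^\vee$, so that they define regular functions $V_1,\dots,V_k,X_1,\dots,X_{n+1}$ on $\mathcal{Y}_{n,k}$. Then the morphism $$(V_1,\dots,V_k,X_1,\dots,X_{n+1}):\ \mathcal{Y}_{n,k}\to\mathbb{A}^{n+k+1}_R$$ is projective, i.e. it factors as a closed immersion into a projective space $\mathbb{P}^N_{\mathbb{A}^{n+k+1}_R}$ followed by the projection. In particular $\mathcal{Y}_{n,k}$ is separated over $R$. -/

import Mathlib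

open CategoryTheory CategoryTheory.Limits AlgebraicGeometry

universe u

noncomputable section

/-! ### Projective morphisms -/

/-- Projective `N`-space over `ℤ`, in the universe `u`. -/
def projSpaceInt (N : ℕ) : Scheme.{u} :=
  letI := MvPolynomial.gradedAlgebra (σ := Fin (N + 1)) (R := ULift.{u} ℤ)
  Proj (MvPolynomial.homogeneousSubmodule (Fin (N + 1)) (ULift.{u} ℤ))

/-- Projective `N`-space over a scheme `S`: the product of `S` and projective `N`-space over `ℤ`. -/
def projSpace (N : ℕ) (S : Scheme.{u}) : Scheme.{u} :=
  pullback (terminal.from S) (terminal.from (projSpaceInt.{u} N))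

/-- The projection of projective `N`-space over `S` to `S`. -/
def projSpaceToBase (N : ℕ) (S : Scheme.{u}) : projSpace N S ⟶ S :=
  pullback.fst (terminal.from S) (terminal.from (projSpaceInt.{u} N))

/-- A morphism `f : X ⟶ S` is projective if it factors as a closed immersion into some projective
space over `S`, followed by the projection to `S`. -/
def IsProjectiveMorphism {X S : Scheme.{u}} (f : X ⟶ S) : Prop :=
  ∃ (N : ℕ) (i : X ⟶ projSpace N S), IsClosedImmersion i ∧ i ≫ projSpaceToBase N S = f

/-! ### Toric schemes glued from affine toric charts

A cone `σ` in the dual of a lattice `H` is represented by the submonoid `M = σ^∨ ∩ H` of `H`.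
The face `σ ∩ t^⊥` of `σ`, for `t ∈ M`, then corresponds to the submonoid `M + ℕ (-t)`, and every
face is of this form. -/

section ToricGluing

variable {H : Type} [AddCommGroup H]

/-- `M'` is the dual monoid of a face of the cone whose dual monoid is `M`. -/
def IsFaceOf (M' M : AddSubmonoid H) : Prop :=
  ∃ t ∈ M, M' = M ⊔ AddSubmonoid.multiples (-t)

theorem IsFaceOf.le {M' M : AddSubmonoid H} (h : IsFaceOf M' M) : M ≤ M' := by
  obtain ⟨t, -, rfl⟩ := h
  exact le_sup_left

theorem IsFaceOf.rfl' (M : AddSubmonoid H) : IsFaceOf M M := by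
  refine ⟨0, M.zero_mem, ?_⟩
  simp [AddSubmonoid.multiples_eq_closure]

theorem sup_multiples_neg_add (M : AddSubmonoid H) {s t : H} (hs : s ∈ M) (ht : t ∈ M) :
    M ⊔ AddSubmonoid.multiples (-(s + t)) =
      M ⊔ AddSubmonoid.multiples (-s) ⊔ AddSubmonoid.multiples (-t) := by
  apply le_antisymm
  · refine sup_le (le_sup_left.trans le_sup_left) ?_
    rw [AddSubmonoid.multiples_le, neg_add]
    exact add_mem
      (AddSubmonoid.mem_sup_left (AddSubmonoid.mem_sup_right (AddSubmonoid.mem_multiples _)))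
      (AddSubmonoid.mem_sup_right (AddSubmonoid.mem_multiples _))
  · have h : -(s + t) ∈ M ⊔ AddSubmonoid.multiples (-(s + t)) :=
      AddSubmonoid.mem_sup_right (AddSubmonoid.mem_multiples _)
    refine sup_le (sup_le le_sup_left ?_) ?_
    · rw [AddSubmonoid.multiples_le]
      have := add_mem h (AddSubmonoid.mem_sup_left ht)
      simpa using this
    · rw [AddSubmonoid.multiples_le]
      have := add_mem h (AddSubmonoid.mem_sup_left hs)
      simpa using this

theorem IsFaceOf.trans {M'' M' M : AddSubmonoid H} (h₂ : IsFaceOf M'' M') (h₁ : IsFaceOf M' M) :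
    IsFaceOf M'' M := by
  obtain ⟨t, ht, rfl⟩ := h₁
  obtain ⟨s, hs, rfl⟩ := h₂
  obtain ⟨m, hm, z, hz, rfl⟩ := AddSubmonoid.mem_sup.mp hs
  obtain ⟨a, rfl⟩ := hz
  refine ⟨m + t, add_mem hm ht, ?_⟩
  rw [sup_multiples_neg_add M hm ht]
  apply le_antisymm
  · refine sup_le (sup_le (le_sup_left.trans le_sup_left) le_sup_right) ?_
    rw [AddSubmonoid.multiples_le]
    have h1 : -m ∈ M ⊔ AddSubmonoid.multiples (-m) ⊔ AddSubmonoid.multiples (-t) :=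
      AddSubmonoid.mem_sup_left (AddSubmonoid.mem_sup_right (AddSubmonoid.mem_multiples _))
    have h2 : a • t ∈ M ⊔ AddSubmonoid.multiples (-m) ⊔ AddSubmonoid.multiples (-t) :=
      AddSubmonoid.mem_sup_left (AddSubmonoid.mem_sup_left (M.nsmul_mem ht a))
    have := add_mem h1 h2
    convert this using 1
    simp [add_comm]
  · refine sup_le (sup_le (le_sup_left.trans le_sup_left) ?_)
      (le_sup_right.trans le_sup_left)
    rw [AddSubmonoid.multiples_le]
    have h1 : -(m + a • -t) ∈ M ⊔ AddSubmonoid.multiples (-t) ⊔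
        AddSubmonoid.multiples (-(m + a • -t)) :=
      AddSubmonoid.mem_sup_right (AddSubmonoid.mem_multiples _)
    have h2 : a • -t ∈ M ⊔ AddSubmonoid.multiples (-t) ⊔
        AddSubmonoid.multiples (-(m + a • -t)) :=
      AddSubmonoid.mem_sup_left (AddSubmonoid.mem_sup_right
        (nsmul_mem (AddSubmonoid.mem_multiples _) a))
    have := add_mem h1 h2
    convert this using 1
    abel

/-- The collection of all faces of a collection `C` of cones, given by their dual monoids. -/
structure ConeFaces (C : Set (AddSubmonoid H)) : Type where
  /-- The dual monoid of the face. -/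
  monoid : AddSubmonoid H
  isFace : ∃ M₀ ∈ C, IsFaceOf monoid M₀

/-- The faces are ordered by `τ ≤ σ` if and only if `τ` is a face of `σ`. -/
instance (C : Set (AddSubmonoid H)) : Preorder (ConeFaces C) where
  le τ σ := IsFaceOf τ.monoid σ.monoid
  le_refl τ := IsFaceOf.rfl' τ.monoid
  le_trans _ _ _ h₁ h₂ := h₁.trans h₂

variable (R : Type u) [CommRing R]

/-- The inclusion of monoid rings `R[M] → R[M']` for submonoids `M ≤ M'`. -/
def monoidRingMap {M M' : AddSubmonoid H} (h : M ≤ M') :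
    AddMonoidAlgebra R M →+* AddMonoidAlgebra R M' :=
  AddMonoidAlgebra.mapDomainRingHom R (AddSubmonoid.inclusion h)

theorem monoidRingMap_single {M M' : AddSubmonoid H} (h : M ≤ M') (m : M) (r : R) :
    monoidRingMap R h (AddMonoidAlgebra.single m r) =
      AddMonoidAlgebra.single (AddSubmonoid.inclusion h m) r := by
  simp [monoidRingMap]

theorem monoidRingMap_refl (M : AddSubmonoid H) :
    monoidRingMap R (le_refl M) = RingHom.id (AddMonoidAlgebra R M) :=
  AddMonoidAlgebra.mapDomainRingHom_id (R := R) (M := M)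

theorem monoidRingMap_comp {M M' M'' : AddSubmonoid H} (h : M ≤ M') (h' : M' ≤ M'') :
    (monoidRingMap R h').comp (monoidRingMap R h) = monoidRingMap R (h.trans h') :=
  (AddMonoidAlgebra.mapDomainRingHom_comp (R := R) (AddSubmonoid.inclusion h')
    (AddSubmonoid.inclusion h)).symm

theorem monoidRingMap_injective {M M' : AddSubmonoid H} (h : M ≤ M') :
    Function.Injective (monoidRingMap R h) :=
  AddMonoidAlgebra.mapDomain_injective (AddSubmonoid.inclusion_injective h)

theorem monoidRingMap_isLocalization (M : AddSubmonoid H) {t : H} (ht : t ∈ M)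
    {M' : AddSubmonoid H} (hM' : M' = M ⊔ AddSubmonoid.multiples (-t)) (h : M ≤ M') :
    letI := (monoidRingMap R h).toAlgebra
    IsLocalization.Away (AddMonoidAlgebra.single (⟨t, ht⟩ : M) (1 : R))
      (AddMonoidAlgebra R M') := by
  let := (monoidRingMap R h).toAlgebra
  have hneg : -t ∈ M' := hM' ▸ AddSubmonoid.mem_sup_right (AddSubmonoid.mem_multiples _)
  have hpow : ∀ N : ℕ, (AddMonoidAlgebra.single (⟨t, ht⟩ : M) (1 : R)) ^ N =
      AddMonoidAlgebra.single (N • (⟨t, ht⟩ : M)) (1 : R) := fun N ↦ by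
    simp [AddMonoidAlgebra.single_pow]
  refine IsLocalization.Away.mk _ ?_ ?_ ?_
  · rw [RingHom.algebraMap_toAlgebra, monoidRingMap_single]
    refine IsUnit.of_mul_eq_one (AddMonoidAlgebra.single (⟨-t, hneg⟩ : M') (1 : R)) ?_
    rw [AddMonoidAlgebra.single_mul_single, AddMonoidAlgebra.one_def]
    congr 1
    · ext; simp
    · simp
  · intro f
    induction f using AddMonoidAlgebra.induction_linear with
    | zero => exact ⟨0, 0, by simp⟩
    | add f g hf hg =>
      obtain ⟨a, x, hx⟩ := hf
      obtain ⟨b, y, hy⟩ := hg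
      refine ⟨a + b, x * (AddMonoidAlgebra.single (⟨t, ht⟩ : M) (1 : R)) ^ b +
        y * (AddMonoidAlgebra.single (⟨t, ht⟩ : M) (1 : R)) ^ a, ?_⟩
      rw [map_add, map_mul, map_mul, ← hx, ← hy, map_pow, map_pow]
      ring
    | single m r =>
      obtain ⟨m, hm⟩ := m
      have hm2 := hm
      rw [hM'] at hm2
      obtain ⟨x, hx, z, hz, rfl⟩ := AddSubmonoid.mem_sup.mp hm2
      obtain ⟨a, rfl⟩ := hz
      refine ⟨a, AddMonoidAlgebra.single (⟨x, hx⟩ : M) r, ?_⟩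
      rw [← map_pow, hpow, RingHom.algebraMap_toAlgebra, monoidRingMap_single,
        monoidRingMap_single, AddMonoidAlgebra.single_mul_single]
      congr 1
      · ext; simp
      · simp
  · intro a b hab
    exact ⟨0, by rw [monoidRingMap_injective R h hab]⟩

variable (C : Set (AddSubmonoid H))

/-- The diagram of the affine toric charts `Spec R[τ^∨ ∩ H]` of all faces `τ`, with a map for every
pair of a cone and a face of it. -/
def toricDiagram : ConeFaces C ⥤ Scheme.{u} where
  obj τ := Spec (.of (AddMonoidAlgebra R τ.monoid))
  map {_ _} f := Spec.map (CommRingCat.ofHom (monoidRingMap R (leOfHom f).le))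
  map_id τ := by
    rw [← Spec.map_id, monoidRingMap_refl]
    rfl
  map_comp {σ τ ρ} f g := by
    rw [← Spec.map_comp, ← CommRingCat.ofHom_comp, monoidRingMap_comp]

instance toricDiagram_isOpenImmersion {σ τ : ConeFaces C} (f : σ ⟶ τ) :
    IsOpenImmersion ((toricDiagram R C).map f) := by
  obtain ⟨t, ht, hM⟩ := leOfHom f
  let := (monoidRingMap R (leOfHom f).le).toAlgebra
  have := monoidRingMap_isLocalization R τ.monoid ht hM (leOfHom f).le
  exact IsOpenImmersion.of_isLocalization (R := AddMonoidAlgebra R τ.monoid)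
    (S := AddMonoidAlgebra R σ.monoid) (AddMonoidAlgebra.single (⟨t, ht⟩ : τ.monoid) (1 : R))

theorem range_toricDiagram_map {σ τ : ConeFaces C} (f : σ ⟶ τ) {t : H} (ht : t ∈ τ.monoid)
    (hM : σ.monoid = τ.monoid ⊔ AddSubmonoid.multiples (-t)) :
    Set.range ((toricDiagram R C).map f) =
      ((PrimeSpectrum.basicOpen (AddMonoidAlgebra.single (⟨t, ht⟩ : τ.monoid) (1 : R)) :
        TopologicalSpace.Opens (PrimeSpectrum (AddMonoidAlgebra R τ.monoid))) :
        Set (PrimeSpectrum (AddMonoidAlgebra R τ.monoid))) := by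
  let := (monoidRingMap R (leOfHom f).le).toAlgebra
  have := monoidRingMap_isLocalization R τ.monoid ht hM (leOfHom f).le
  exact PrimeSpectrum.localization_away_comap_range (AddMonoidAlgebra R σ.monoid)
    (AddMonoidAlgebra.single (⟨t, ht⟩ : τ.monoid) (1 : R))

instance toricDiagram_isLocallyDirected :
    (toricDiagram R C ⋙ Scheme.forget).IsLocallyDirected where
  cond {i j k} fi fj xi xj hx := by
    obtain ⟨s, hs, hMi⟩ := leOfHom fi
    obtain ⟨t, ht, hMj⟩ := leOfHom fj
    have hx' : (toricDiagram R C).map fi xi = (toricDiagram R C).map fj xj := hx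
    have hlk : IsFaceOf (k.monoid ⊔ AddSubmonoid.multiples (-(s + t))) k.monoid :=
      ⟨s + t, add_mem hs ht, rfl⟩
    obtain ⟨M₀, hM₀, hk⟩ := k.isFace
    let l : ConeFaces C := ⟨_, M₀, hM₀, hlk.trans hk⟩
    have hli : IsFaceOf l.monoid i.monoid :=
      ⟨t, hMi ▸ AddSubmonoid.mem_sup_left ht, by rw [hMi]; exact sup_multiples_neg_add k.monoid hs ht⟩
    have hlj : IsFaceOf l.monoid j.monoid :=
      ⟨s, hMj ▸ AddSubmonoid.mem_sup_left hs, by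
        rw [hMj, ← sup_multiples_neg_add k.monoid ht hs, add_comm t s]⟩
    let fli : l ⟶ i := homOfLE hli
    let flj : l ⟶ j := homOfLE hlj
    let flk : l ⟶ k := homOfLE hlk
    have h1 : (toricDiagram R C).map fi xi ∈ Set.range ((toricDiagram R C).map fi) := ⟨xi, rfl⟩
    have h2 : (toricDiagram R C).map fi xi ∈ Set.range ((toricDiagram R C).map fj) :=
      ⟨xj, hx'.symm⟩
    rw [range_toricDiagram_map R C fi hs hMi] at h1
    rw [range_toricDiagram_map R C fj ht hMj] at h2
    have h3 : (toricDiagram R C).map fi xi ∈ Set.range ((toricDiagram R C).map flk) := by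
      rw [range_toricDiagram_map R C flk (add_mem hs ht) rfl]
      have : AddMonoidAlgebra.single (⟨s + t, add_mem hs ht⟩ : k.monoid) (1 : R) =
          AddMonoidAlgebra.single (⟨s, hs⟩ : k.monoid) (1 : R) *
            AddMonoidAlgebra.single (⟨t, ht⟩ : k.monoid) (1 : R) := by
        rw [AddMonoidAlgebra.single_mul_single, one_mul]
        rfl
      rw [this, PrimeSpectrum.basicOpen_mul]
      exact ⟨h1, h2⟩
    obtain ⟨y, hy⟩ := h3
    refine ⟨l, fli, flj, y, ?_, ?_⟩
    · apply ((toricDiagram R C).map fi).isOpenEmbedding.injective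
      change (toricDiagram R C).map fi ((toricDiagram R C).map fli y) = _
      rw [← Scheme.Hom.comp_apply, ← Functor.map_comp]
      exact hy
    · apply ((toricDiagram R C).map fj).isOpenEmbedding.injective
      change (toricDiagram R C).map fj ((toricDiagram R C).map flj y) = _
      rw [← Scheme.Hom.comp_apply, ← Functor.map_comp]
      exact hy.trans hx'

/-- The toric scheme over `R` obtained by gluing the affine charts `Spec R[σ^∨ ∩ H]` of the cones
in `C` along the open subschemes that correspond to common faces. (No compatibility of the
cones is assumed, so it is not separated in general.) -/
def toricScheme : Scheme.{u} := colimit (toricDiagram R C)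

/-- The structure morphism of the toric scheme. -/
def toricSchemeToBase : toricScheme R C ⟶ Spec (.of R) :=
  colimit.desc (toricDiagram R C)
    { pt := Spec (.of R)
      ι :=
        { app := fun τ ↦ Spec.map (CommRingCat.ofHom (algebraMap R (AddMonoidAlgebra R τ.monoid)))
          naturality := fun {σ τ} f ↦ by
            simp only [Functor.const_obj_obj, Functor.const_obj_map]
            change Spec.map _ ≫ Spec.map _ = _
            rw [← Spec.map_comp, ← CommRingCat.ofHom_comp]
            congr 2
            ext r : 1
            simp [AddMonoidAlgebra.coe_algebraMap, monoidRingMap_single] } }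

/-- For elements `w s` of `H` that lie in all dual cones of `C`, the morphism from the toric scheme
to the affine space `Spec R[T_s : s]` whose coordinate `T_s` is the monomial of weight `w s`. -/
def toricMonomialMap {S : Type} (w : S → H) (hw : ∀ M ∈ C, ∀ s, w s ∈ M) :
    toricScheme R C ⟶ Spec (.of (MvPolynomial S R)) :=
  colimit.desc (toricDiagram R C)
    { pt := Spec (.of (MvPolynomial S R))
      ι :=
        { app := fun τ ↦ Spec.map (CommRingCat.ofHom
            (MvPolynomial.aeval (R := R) (fun s ↦ AddMonoidAlgebra.single
              (⟨w s, by
                obtain ⟨M₀, h₀, h⟩ := τ.isFace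
                exact h.le (hw M₀ h₀ s)⟩ : τ.monoid) (1 : R))).toRingHom)
          naturality := fun {σ τ} f ↦ by
            simp only [Functor.const_obj_obj, Functor.const_obj_map]
            change Spec.map _ ≫ Spec.map _ = _
            rw [← Spec.map_comp, ← CommRingCat.ofHom_comp]
            congr 2
            apply MvPolynomial.ringHom_ext
            · intro r
              simp [AddMonoidAlgebra.coe_algebraMap, monoidRingMap_single]
            · intro s
              simp [monoidRingMap_single]
              rfl } }

end ToricGluing

/-! ### The toric scheme `Y_{n,k}` -/

/-- The first homology lattice of the sphere with `n + 1 + k` punctures: it is generated by the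
boundary circles `x_1, …, x_{n+1}` and `v_1, …, v_k` (the latter with reversed orientation), with
the single relation `∑ x_i = ∑ v_j`. -/
abbrev PuncturedLattice (n k : ℕ) : Type :=
  ((Fin (n + 1) → ℤ) × (Fin k → ℤ)) ⧸ AddSubgroup.zmultiples
    ((fun _ ↦ 1, fun _ ↦ -1) : (Fin (n + 1) → ℤ) × (Fin k → ℤ))

variable (n k : ℕ)

/-- The class `x_{i+1}` in the lattice. -/
def xClass (i : Fin (n + 1)) : PuncturedLattice n k :=
  QuotientAddGroup.mk (Pi.single i 1, 0)

/-- The class `v_{j+1}` in the lattice. -/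
def vClass (j : Fin k) : PuncturedLattice n k :=
  QuotientAddGroup.mk (0, Pi.single j 1)

/-- The class `c_{ij} = v_k + v_{k-1} + … + v_{j+1} - x_1 - … - x_i` in the lattice. -/
def cClass (i j : ℕ) : PuncturedLattice n k :=
  ∑ l : Fin k with j ≤ l.val, vClass n k l - ∑ m : Fin (n + 1) with m.val < i, xClass n k m

/-- The set of classes `S_φ` for a function `φ : [1,n] → [1,k]`. Both `[1,n]` and `[1,k]` are indexed
from `0` here, so that `a : Fin n` stands for `i = a + 1`, with `φ(i) = φ a + 1`. -/
def chartGenerators (φ : Fin n → Fin k) : Set (PuncturedLattice n k) :=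
  {h | ∃ j : Fin k, j ∉ Set.range φ ∧ h = vClass n k j} ∪
  {h | ∃ a b : Fin n, a.val + 1 = b.val ∧ φ a = φ b ∧ h = xClass n k b.castSucc} ∪
  {h | ∃ a : Fin n, (∀ b : Fin n, b.val + 1 = a.val → φ a < φ b) ∧
    h = -cClass n k (a.val + 1) ((φ a).val + 1)} ∪
  {h | ∃ a : Fin n, (∀ b : Fin n, a.val + 1 = b.val → φ b < φ a) ∧
    h = cClass n k (a.val + 1) (φ a).val}

/-- The dual monoid `σ_φ^∨ ∩ H` of the cone `σ_φ`. As `S_φ` is a basis of the lattice, this is the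
monoid generated by `S_φ`, and its monoid ring is the polynomial ring in the variables `S_φ`. -/
def chartMonoid (φ : Fin n → Fin k) : AddSubmonoid (PuncturedLattice n k) :=
  AddSubmonoid.closure (chartGenerators n k φ)

/-- The dual monoids of the cones `σ_φ`, for `φ` nonincreasing, and of the zero cone (which is a
face of each `σ_φ`, and is listed only because there is no `φ` if `k = 0 < n`). -/
def yCones : Set (AddSubmonoid (PuncturedLattice n k)) :=
  insert ⊤ {M | ∃ φ : Fin n → Fin k, Antitone φ ∧ M = chartMonoid n k φ}

/-- The weights `v_1, …, v_k, x_1, …, x_{n+1}`. -/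
def yWeights : Fin k ⊕ Fin (n + 1) → PuncturedLattice n k :=
  Sum.elim (vClass n k) (xClass n k)

variable {n k}

theorem sum_xClass_eq_sum_vClass : ∑ i, xClass n k i = ∑ j, vClass n k j := by
  have h1 : ∑ i, xClass n k i = QuotientAddGroup.mk ((fun _ ↦ 1, 0)) := by
    have : ((fun _ ↦ 1, 0) : (Fin (n + 1) → ℤ) × (Fin k → ℤ)) =
        ∑ i : Fin (n + 1), (Pi.single i 1, 0) := by
      ext m <;> simp [Prod.fst_sum, Prod.snd_sum, Finset.sum_apply, Pi.single_apply]
    rw [this]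
    exact (map_sum (QuotientAddGroup.mk' (AddSubgroup.zmultiples
      ((fun _ ↦ 1, fun _ ↦ -1) : (Fin (n + 1) → ℤ) × (Fin k → ℤ)))) _ _).symm
  have h2 : ∑ j, vClass n k j = QuotientAddGroup.mk ((0, fun _ ↦ 1)) := by
    have : ((0, fun _ ↦ 1) : (Fin (n + 1) → ℤ) × (Fin k → ℤ)) =
        ∑ j : Fin k, (0, Pi.single j 1) := by
      ext m <;> simp [Prod.fst_sum, Prod.snd_sum, Finset.sum_apply, Pi.single_apply]
    rw [this]
    exact (map_sum (QuotientAddGroup.mk' (AddSubgroup.zmultiples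
      ((fun _ ↦ 1, fun _ ↦ -1) : (Fin (n + 1) → ℤ) × (Fin k → ℤ)))) _ _).symm
  rw [h1, h2, eq_comm, QuotientAddGroup.eq]
  refine AddSubgroup.mem_zmultiples_iff.mpr ⟨1, ?_⟩
  ext m <;> simp

theorem cClass_left (i : Fin (n + 1)) (j : ℕ) :
    cClass n k i.val j = cClass n k (i.val + 1) j + xClass n k i := by
  have : (Finset.univ.filter fun m : Fin (n + 1) ↦ m.val < i.val + 1) =
      insert i (Finset.univ.filter fun m : Fin (n + 1) ↦ m.val < i.val) := by
    ext m
    simp [Fin.ext_iff]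
    omega
  rw [cClass, cClass, this, Finset.sum_insert (by simp)]
  abel

theorem cClass_right (i : ℕ) (j : Fin k) :
    cClass n k i j.val = cClass n k i (j.val + 1) + vClass n k j := by
  have : (Finset.univ.filter fun l : Fin k ↦ j.val ≤ l.val) =
      insert j (Finset.univ.filter fun l : Fin k ↦ j.val + 1 ≤ l.val) := by
    ext m
    simp [Fin.ext_iff]
    omega
  rw [cClass, cClass, this, Finset.sum_insert (by simp)]
  abel

theorem cClass_zero_left : cClass n k 0 k = 0 := by
  have : (Finset.univ.filter fun l : Fin k ↦ k ≤ l.val) = ∅ := by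
    ext m
    simp
  simp [cClass, this]

theorem cClass_zero_right : cClass n k (n + 1) 0 = 0 := by
  have : (Finset.univ.filter fun m : Fin (n + 1) ↦ m.val < n + 1) = Finset.univ := by
    ext m
    simp
    omega
  rw [cClass, this, sum_xClass_eq_sum_vClass]
  simp

theorem neg_cClass_mem (φ : Fin n → Fin k) (hφ : Antitone φ) (a : ℕ) (ha : a < n) :
    -cClass n k (a + 1) ((φ ⟨a, ha⟩).val + 1) ∈ chartMonoid n k φ := by
  induction a with
  | zero =>
    refine AddSubmonoid.subset_closure (Or.inl (Or.inr ⟨⟨0, ha⟩, ?_, rfl⟩))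
    intro b hb
    simp at hb
  | succ a ih =>
    have ha' : a < n := by omega
    rcases (hφ (show (⟨a, ha'⟩ : Fin n) ≤ ⟨a + 1, ha⟩ by simp)).lt_or_eq with h | h
    · refine AddSubmonoid.subset_closure (Or.inl (Or.inr ⟨⟨a + 1, ha⟩, ?_, rfl⟩))
      intro b hb
      obtain rfl : b = ⟨a, ha'⟩ := Fin.ext (by simpa using hb)
      exact h
    · have h1 := cClass_left (n := n) (k := k) ⟨a + 1, by omega⟩ ((φ ⟨a, ha'⟩).val + 1)
      have h2 : xClass n k ⟨a + 1, by omega⟩ ∈ chartMonoid n k φ :=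
        AddSubmonoid.subset_closure
          (Or.inl (Or.inl (Or.inr ⟨⟨a, ha'⟩, ⟨a + 1, ha⟩, rfl, h.symm, rfl⟩)))
      have h3 := add_mem (ih ha') h2
      rw [h1] at h3
      rw [h]
      simpa using h3

theorem cClass_mem (φ : Fin n → Fin k) (hφ : Antitone φ) (d a : ℕ) (ha : a < n)
    (hd : a + d + 1 = n) :
    cClass n k (a + 1) (φ ⟨a, ha⟩).val ∈ chartMonoid n k φ := by
  induction d generalizing a with
  | zero =>
    refine AddSubmonoid.subset_closure (Or.inr ⟨⟨a, ha⟩, ?_, rfl⟩)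
    intro b hb
    have := b.isLt
    simp at hb
    omega
  | succ d ih =>
    have ha' : a + 1 < n := by omega
    rcases (hφ (show (⟨a, ha⟩ : Fin n) ≤ ⟨a + 1, ha'⟩ by simp)).lt_or_eq with h | h
    · refine AddSubmonoid.subset_closure (Or.inr ⟨⟨a, ha⟩, ?_, rfl⟩)
      intro b hb
      obtain rfl : b = ⟨a + 1, ha'⟩ := Fin.ext (by simpa using hb.symm)
      exact h
    · have h1 := cClass_left (n := n) (k := k) ⟨a + 1, by omega⟩ (φ ⟨a, ha⟩).val
      have h2 : xClass n k ⟨a + 1, by omega⟩ ∈ chartMonoid n k φ :=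
        AddSubmonoid.subset_closure
          (Or.inl (Or.inl (Or.inr ⟨⟨a, ha⟩, ⟨a + 1, ha'⟩, rfl, h.symm, rfl⟩)))
      have h3 := add_mem (ih (a + 1) ha' (by omega)) h2
      rw [h] at h3
      exact h1 ▸ h3

theorem vClass_mem (φ : Fin n → Fin k) (hφ : Antitone φ) (j : Fin k) :
    vClass n k j ∈ chartMonoid n k φ := by
  by_cases hj : j ∈ Set.range φ
  · obtain ⟨a, rfl⟩ := hj
    have h := add_mem (cClass_mem φ hφ (n - 1 - a) a a.isLt (by omega))
      (neg_cClass_mem φ hφ a a.isLt)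
    rw [Fin.eta, cClass_right] at h
    simpa using h
  · exact AddSubmonoid.subset_closure (Or.inl (Or.inl (Or.inl ⟨j, hj, rfl⟩)))

theorem cClass_sub_mem (φ : Fin n → Fin k) (hφ : Antitone φ) (i j j' : ℕ) (h : j ≤ j')
    (hj' : j' ≤ k) : cClass n k i j - cClass n k i j' ∈ chartMonoid n k φ := by
  induction j', h using Nat.le_induction with
  | base => simp
  | succ m hm ih =>
    have h1 := cClass_right (n := n) i ⟨m, hj'⟩
    have h2 := add_mem (ih (by omega)) (vClass_mem φ hφ ⟨m, hj'⟩)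
    simp only at h1
    rw [h1] at h2
    convert h2 using 1
    abel

theorem xClass_mem (φ : Fin n → Fin k) (hφ : Antitone φ) (m : Fin (n + 1)) :
    xClass n k m ∈ chartMonoid n k φ := by
  have key : ∀ j l : ℕ, l ≤ j → j ≤ k → cClass n k m.val j ∈ chartMonoid n k φ →
      -cClass n k (m.val + 1) l ∈ chartMonoid n k φ → xClass n k m ∈ chartMonoid n k φ := by
    intro j l hlj hj h1 h2
    have h3 := add_mem (add_mem h1 (cClass_sub_mem φ hφ (m.val + 1) l j hlj hj)) h2
    rw [cClass_left m j] at h3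
    convert h3 using 1
    abel
  obtain ⟨m, hm⟩ := m
  rcases Nat.eq_zero_or_pos m with rfl | hm0
  · rcases Nat.eq_zero_or_pos n with rfl | hn
    · exact key k 0 (by omega) le_rfl (by simp [cClass_zero_left])
        (by
          have h0 : cClass 0 k (0 + 1) 0 = 0 := cClass_zero_right
          change -cClass 0 k (0 + 1) 0 ∈ _
          rw [h0, neg_zero]
          exact zero_mem _)
    · exact key k _ (φ ⟨0, hn⟩).isLt le_rfl (by simp [cClass_zero_left])
        (neg_cClass_mem φ hφ 0 hn)
  · obtain ⟨p, rfl⟩ : ∃ p, m = p + 1 := ⟨m - 1, by omega⟩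
    have hp : p < n := by omega
    have h1 := cClass_mem φ hφ (n - 1 - p) p hp (by omega)
    rcases (show p + 1 = n ∨ p + 1 < n by omega) with rfl | hm'
    · exact key _ 0 (by omega) (φ ⟨p, hp⟩).isLt.le h1 (by simp [cClass_zero_right])
    · rcases (hφ (show (⟨p, hp⟩ : Fin n) ≤ ⟨p + 1, hm'⟩ by simp)).lt_or_eq with h | h
      · exact key _ _ h (φ ⟨p, hp⟩).isLt.le h1 (neg_cClass_mem φ hφ (p + 1) hm')
      · exact AddSubmonoid.subset_closure
          (Or.inl (Or.inl (Or.inr ⟨⟨p, hp⟩, ⟨p + 1, hm'⟩, rfl, h.symm, rfl⟩)))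

theorem yWeights_mem (M : AddSubmonoid (PuncturedLattice n k)) (hM : M ∈ yCones n k)
    (s : Fin k ⊕ Fin (n + 1)) : yWeights n k s ∈ M := by
  rcases hM with rfl | ⟨φ, hφ, rfl⟩
  · exact AddSubmonoid.mem_top _
  · rcases s with j | i
    · exact vClass_mem φ hφ j
    · exact xClass_mem φ hφ i

/-- The toric scheme `Y_{n,k}` over `R`. -/
def toricY (R : Type u) [CommRing R] (n k : ℕ) : Scheme.{u} :=
  toricScheme R (yCones n k)

/-- The structure morphism of `Y_{n,k}`. -/
def toricYToBase (R : Type u) [CommRing R] (n k : ℕ) : toricY R n k ⟶ Spec (.of R) :=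
  toricSchemeToBase R (yCones n k)

/-- The morphism `(V_1, …, V_k, X_1, …, X_{n+1})` from `Y_{n,k}` to the affine space of dimension
`n + k + 1` over `R`. -/
def toricYToAffineSpace (R : Type u) [CommRing R] (n k : ℕ) :
    toricY R n k ⟶ Spec (.of (MvPolynomial (Fin k ⊕ Fin (n + 1)) R)) :=
  toricMonomialMap R (yCones n k) (yWeights n k) yWeights_mem

end

/-! The argument is the toric one: a piecewise linear support function on the fan supplies
homogeneous coordinates.

Suppose that the maximal charts have the monoids `fractionMonoid w z i`, generated by the weights `w
s` and the differences `z j - z i` for a finite family `z`. Then the monomials of weights `z j` are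
homogeneous coordinates of a morphism to projective space: on the chart of `i` they are divided by
the one of weight `z i`, and another choice of `i` rescales them by a unit. The locus where the
`i`-th coordinate is invertible is exactly the chart of `i` (`toricToProj_preimage_basicOpen`). Over
this locus the functions `T_s` and `X_j / X_i` pull back to the generators of the monoid ring, so
that the map to projective space over affine space is a closed immersion
(`isProjectiveMorphism_toricMonomialMap`).

For `Y_{n,k}` the coordinates are indexed by the nonincreasing `φ`, with `z_φ` the sum of all
`c_{il}` with `φ(i) ≤ l < k`. On the cone of `φ` the values of `c_{il}` decrease weakly in `l`,
because consecutive ones differ by some `v_j`; they are nonnegative for `l < φ(i)` and nonpositive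
for `l ≥ φ(i)`. Hence `z_φ` is the least of all `z_ψ` there, i.e. `z_ψ - z_φ` lies in the dual
monoid (`coordinateWeight_sub_mem`). Conversely, raising or lowering a single value `φ(i)` by one
changes `z_φ` by `-c_{i,φ(i)}` or `c_{i,φ(i)-1}`, and the side conditions in `S_φ` say precisely
that the new function is still nonincreasing. If the new value would leave `[1,k]`, the class is a
sum of `x`'s instead. So the charts have the required form (`fractionMonoid_eq_chartMonoid`). -/

noncomputable section

/-! ### Morphisms from affine schemes to `Proj` -/

section SpecToProj

open HomogeneousLocalization

variable {σ : Type*} {A : Type u} [CommRing A] [SetLike σ A] [AddSubgroupClass σ A]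
  (𝒜 : ℕ → σ) [GradedRing 𝒜] {B B' : Type u} [CommRing B] [CommRing B']

/-- The homomorphism from the degree zero part of `A_f` to `B` induced by a homomorphism `A → B`
that maps `f` to a unit. -/
def awayEval (φ : A →+* B) {f : A} (hf : IsUnit (φ f)) : Away 𝒜 f →+* B :=
  (IsLocalization.Away.lift (S := Localization.Away f) f hf).comp
    (algebraMap (Away 𝒜 f) (Localization.Away f))

/-- Clearing the denominator determines `awayEval`, because every element of the degree zero part is
such a fraction and `φ f` is a unit. -/
theorem awayEval_mk_mul (φ : A →+* B) {f : A} (hf : IsUnit (φ f)) {d : ℕ} (hd : f ∈ 𝒜 d) (n : ℕ)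
    (x : A) (hx : x ∈ 𝒜 (n • d)) :
    awayEval 𝒜 φ hf (Away.mk 𝒜 hd n x hx) * φ f ^ n = φ x := by
  simp only [awayEval, RingHom.coe_comp, Function.comp_apply, HomogeneousLocalization.algebraMap_apply, Away.val_mk]
  rw [Localization.mk_eq_mk', ← map_pow, ← IsLocalization.Away.lift_eq (S := Localization.Away f) f hf (f ^ n),
    ← map_mul]
  exact (congrArg _ (IsLocalization.mk'_spec (Localization.Away f) x
    (⟨f ^ n, n, rfl⟩ : Submonoid.powers f))).trans (IsLocalization.Away.lift_eq f hf x)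

theorem awayEval_comp (ψ : B →+* B') (φ : A →+* B) {f : A} (hf : IsUnit (φ f))
    (hf' : IsUnit (ψ.comp φ f)) :
    ψ.comp (awayEval 𝒜 φ hf) = awayEval 𝒜 (ψ.comp φ) hf' := by
  rw [awayEval, awayEval, ← RingHom.comp_assoc]
  congr 1
  apply IsLocalization.ringHom_ext (M := .powers f)
  ext x
  simp

theorem awayEval_awayMap (φ : A →+* B) {f g x : A} {e : ℕ} (hg : g ∈ 𝒜 e) (hx : x = f * g)
    (hf : IsUnit (φ f)) (hx' : IsUnit (φ x)) :
    (awayEval 𝒜 φ hx').comp (awayMap 𝒜 hg hx) = awayEval 𝒜 φ hf := by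
  ext a
  simp only [awayEval, RingHom.coe_comp, Function.comp_apply, HomogeneousLocalization.algebraMap_apply, val_awayMap]
  simp only [← RingHom.comp_apply]
  congr 1
  apply IsLocalization.ringHom_ext (M := .powers f)
  ext x
  simp [IsLocalization.Away.lift, Localization.awayLift]

/-- In a fraction of degree zero the powers of `c` in the numerator and the denominator cancel. -/
theorem awayEval_eq_of_forall_eq_pow_mul {φ φ' : A →+* B} {c : B}
    (h : ∀ n, ∀ x ∈ 𝒜 n, φ' x = c ^ n * φ x) {f : A} {d : ℕ} (hd : f ∈ 𝒜 d)
    (hf : IsUnit (φ f)) (hf' : IsUnit (φ' f)) :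
    awayEval 𝒜 φ hf = awayEval 𝒜 φ' hf' := by
  ext a
  obtain ⟨n, x, hx, rfl⟩ := Away.mk_surjective 𝒜 hd a
  apply (hf'.pow n).mul_right_cancel
  rw [awayEval_mk_mul, h _ _ hd, h _ _ hx, mul_pow, mul_left_comm, awayEval_mk_mul, smul_eq_mul,
    ← pow_mul, mul_comm n d]

/-- The morphism from `Spec B` to `Proj 𝒜` given by a homomorphism `A → B` that maps the
homogeneous element `f` to a unit. -/
def specToProj (φ : A →+* B) {f : A} {d : ℕ} (hd : f ∈ 𝒜 d) (hd' : 0 < d) (hf : IsUnit (φ f)) :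
    Spec (.of B) ⟶ Proj 𝒜 :=
  Spec.map (CommRingCat.ofHom (awayEval 𝒜 φ hf)) ≫ Proj.awayι 𝒜 f hd hd'

theorem SpecMap_comp_specToProj (ψ : B →+* B') (φ : A →+* B) {f : A} {d : ℕ} (hd : f ∈ 𝒜 d)
    (hd' : 0 < d) (hf : IsUnit (φ f)) (hf' : IsUnit (ψ.comp φ f)) :
    Spec.map (CommRingCat.ofHom ψ) ≫ specToProj 𝒜 φ hd hd' hf =
      specToProj 𝒜 (ψ.comp φ) hd hd' hf' := by
  rw [specToProj, specToProj, ← awayEval_comp 𝒜 ψ φ hf, CommRingCat.ofHom_comp, Spec.map_comp,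
    Category.assoc]

theorem specToProj_eq_mul (φ : A →+* B) {f g x : A} {d e : ℕ} (hd : f ∈ 𝒜 d) (hd' : 0 < d)
    (hf : IsUnit (φ f)) (he : g ∈ 𝒜 e) (hx : x = f * g) (hx' : IsUnit (φ x)) :
    specToProj 𝒜 φ hd hd' hf =
      specToProj 𝒜 φ (f := x) (hx ▸ SetLike.mul_mem_graded hd he)
        (hd'.trans_le (d.le_add_right e)) hx' := by
  rw [specToProj, specToProj, ← Proj.SpecMap_awayMap_awayι 𝒜 hd hd' he hx, ← Category.assoc,
    ← Spec.map_comp, ← CommRingCat.ofHom_comp, awayEval_awayMap]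

/-- Both morphisms land in the basic open set of `f * g`, where they can be compared. -/
theorem specToProj_congr (φ : A →+* B) {f g : A} {d e : ℕ} (hd : f ∈ 𝒜 d) (hd' : 0 < d)
    (hf : IsUnit (φ f)) (he : g ∈ 𝒜 e) (he' : 0 < e) (hg : IsUnit (φ g)) :
    specToProj 𝒜 φ hd hd' hf = specToProj 𝒜 φ he he' hg := by
  have hfg : IsUnit (φ (f * g)) := by
    rw [map_mul]
    exact hf.mul hg
  rw [specToProj_eq_mul 𝒜 φ hd hd' hf he rfl hfg,
    specToProj_eq_mul 𝒜 φ he he' hg hd (mul_comm f g) hfg]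
  congr 1
  exact add_comm d e

theorem specToProj_eq_of_forall_eq_pow_mul {φ φ' : A →+* B} {c : B}
    (h : ∀ n, ∀ x ∈ 𝒜 n, φ' x = c ^ n * φ x) {f : A} {d : ℕ} (hd : f ∈ 𝒜 d) (hd' : 0 < d)
    (hf : IsUnit (φ f)) (hf' : IsUnit (φ' f)) :
    specToProj 𝒜 φ hd hd' hf = specToProj 𝒜 φ' hd hd' hf' := by
  rw [specToProj, specToProj, awayEval_eq_of_forall_eq_pow_mul 𝒜 h hd hf hf']

theorem specToProj_preimage_basicOpen (φ : A →+* B) {f g : A} {d e : ℕ} (hd : f ∈ 𝒜 d)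
    (hd' : 0 < d) (hf : IsUnit (φ f)) (he : g ∈ 𝒜 e) (he' : 0 < e) :
    specToProj 𝒜 φ hd hd' hf ⁻¹ᵁ Proj.basicOpen 𝒜 g = PrimeSpectrum.basicOpen (φ g) := by
  -- The locus is cut out by the degree zero fraction `g ^ d / f ^ e`, whose image differs from `φ g
  -- ^ d` by the unit `φ f ^ e`.
  have h := awayEval_mk_mul 𝒜 φ hf hd e (g ^ d)
    (by rw [smul_eq_mul, mul_comm]; exact SetLike.pow_mem_graded d he)
  rw [specToProj, Scheme.Hom.comp_preimage, Proj.awayι_preimage_basicOpen 𝒜 hd hd' he he']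
  change PrimeSpectrum.basicOpen (awayEval 𝒜 φ hf (Away.isLocalizationElem hd he)) = _
  rw [← PrimeSpectrum.basicOpen_pow (φ g) d hd', ← map_pow, ← h, PrimeSpectrum.basicOpen_mul,
    eq_comm, inf_eq_left]
  exact fun x _ hx ↦ x.isPrime.ne_top (Ideal.eq_top_of_isUnit_mem _ hx (hf.pow e))

end SpecToProj

/-! ### Closed immersions -/

/-- Being a closed immersion is local on the target, and the condition on preimages makes each
square cartesian, so that `g i` is the restriction of `f` over `V i`. -/
theorem isClosedImmersion_of_forall_isClosedImmersion {X Y : Scheme.{u}} (f : X ⟶ Y) {ι : Type*}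
    {U V : ι → Scheme.{u}} (iU : ∀ i, U i ⟶ X) (iV : ∀ i, V i ⟶ Y) (g : ∀ i, U i ⟶ V i)
    [∀ i, IsOpenImmersion (iU i)] [∀ i, IsOpenImmersion (iV i)]
    (comm : ∀ i, iU i ≫ f = g i ≫ iV i)
    (preimage : ∀ i, f ⁻¹ᵁ (iV i).opensRange = (iU i).opensRange)
    (cover : ⨆ i, (iV i).opensRange = ⊤) (hg : ∀ i, IsClosedImmersion (g i)) :
    IsClosedImmersion f := by
  refine IsZariskiLocalAtTarget.of_iSup_eq_top _ cover fun i ↦ ?_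
  refine (MorphismProperty.arrow_mk_iso_iff @IsClosedImmersion
    (morphismRestrictOpensRange f (iV i))).mpr ?_
  have h := (IsOpenImmersion.isPullback (g i) (iU i) (iV i) f (comm i) (preimage i)).flip
  have := hg i
  change IsClosedImmersion (pullback.snd f (iV i))
  rw [← h.isoPullback_inv_snd]
  infer_instance

/-- Between affine schemes only surjectivity on global sections is needed, and the image is a
subring that contains the images of `α` and `δ`. In the application `Z` is the product of `Spec A`
and `Spec D`. -/
theorem isClosedImmersion_spec_of_surjective_on_pair {A B D : CommRingCat.{u}} {Z : Scheme.{u}}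
    [IsAffine Z] (p : Z ⟶ Spec A) (q : Z ⟶ Spec D) (h : Spec B ⟶ Z) {α : A ⟶ B} {δ : D ⟶ B}
    (hp : h ≫ p = Spec.map α) (hq : h ≫ q = Spec.map δ)
    (hgen : ∀ T : Subring B, (∀ a, α a ∈ T) → (∀ d, δ d ∈ T) → ∀ b, b ∈ T) : IsClosedImmersion h := by
  have key : ∀ {E : CommRingCat.{u}} (r : Z ⟶ Spec E) (ε : E ⟶ B), h ≫ r = Spec.map ε →
      ∀ x, ε x ∈ ((Scheme.ΓSpecIso B).hom.hom.comp h.appTop.hom).range := by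
    intro E r ε hr x
    refine ⟨r.appTop ((Scheme.ΓSpecIso E).inv x), ?_⟩
    have h1 := Scheme.ΓSpecIso_inv_naturality ε
    rw [← hr, Scheme.Hom.comp_appTop, Iso.comp_inv_eq] at h1
    rw [h1]
    simp
  refine IsClosedImmersion.of_surjective_of_isAffine h fun y ↦ ?_
  obtain ⟨x, hx⟩ : (Scheme.ΓSpecIso B).hom.hom y ∈
      ((Scheme.ΓSpecIso B).hom.hom.comp h.appTop.hom).range :=
    hgen _ (key p α hp) (key q δ hq) _
  exact ⟨x, (Scheme.ΓSpecIso B).commRingCatIsoToRingEquiv.injective hx⟩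

/-! ### Projective space -/

instance (N : ℕ) (S : Scheme.{u}) : IsSeparated (projSpaceToBase N S) := by
  let := MvPolynomial.gradedAlgebra (σ := Fin (N + 1)) (R := ULift.{u} ℤ)
  have : (projSpaceInt.{u} N).IsSeparated :=
    inferInstanceAs
      (Proj (MvPolynomial.homogeneousSubmodule (Fin (N + 1)) (ULift.{u} ℤ))).IsSeparated
  have : IsSeparated (terminal.from (projSpaceInt.{u} N)) := inferInstance
  exact inferInstanceAs (IsSeparated (pullback.fst _ _))

/-- The homogeneous elements `X i` of degree one have the whole of projective space as the union of
their basic open subsets. -/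
theorem iSup_basicOpen_X_eq_top (σ : Type) (R : Type u) [CommRing R] :
    letI := MvPolynomial.gradedAlgebra (σ := σ) (R := R)
    ⨆ i, Proj.basicOpen (MvPolynomial.homogeneousSubmodule σ R) (MvPolynomial.X i) = ⊤ := by
  let := MvPolynomial.gradedAlgebra (σ := σ) (R := R)
  refine Proj.iSup_basicOpen_eq_top' _ _ (fun i ↦ ⟨1, MvPolynomial.isHomogeneous_X R i⟩) ?_
  rw [eq_top_iff]
  rintro p -
  induction p using MvPolynomial.induction_on with
  | C r =>
    exact Subalgebra.algebraMap_mem (Algebra.adjoin _ _)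
      (⟨MvPolynomial.C r, MvPolynomial.isHomogeneous_C σ r⟩ :
        MvPolynomial.homogeneousSubmodule σ R 0)
  | add p q hp hq => exact add_mem hp hq
  | mul_X p i hp => exact mul_mem hp (Algebra.subset_adjoin ⟨i, rfl⟩)

theorem eval₂Hom_mul_of_isHomogeneous {σ R B : Type*} [CommSemiring R] [CommSemiring B] (f : R →+* B)
    (b : σ → B) (c : B) {n : ℕ} {p : MvPolynomial σ R} (hp : p.IsHomogeneous n) :
    MvPolynomial.eval₂Hom f (fun i ↦ c * b i) p = c ^ n * MvPolynomial.eval₂Hom f b p := by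
  simp only [MvPolynomial.coe_eval₂Hom, MvPolynomial.eval₂_eq, Finset.mul_sum, mul_pow,
    Finset.prod_mul_distrib, Finset.prod_pow_eq_pow_sum]
  refine Finset.sum_congr rfl fun d hd ↦ ?_
  rw [← hp (MvPolynomial.mem_support_iff.mp hd), Finsupp.weight_apply, Finsupp.sum]
  simp only [Pi.one_apply, smul_eq_mul, mul_one]
  ring

/-! ### Toric schemes over affine space defined by finitely many homogeneous coordinates -/

section ToricProj

variable {H : Type} [AddCommGroup H] {S ι : Type} (w : S → H) (z : ι → H)

/-- The monoid of weights of regular functions on the locus where the homogeneous coordinate of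
weight `z i` is invertible: it is generated by the weights `w s` and `z j - z i`. -/
def fractionMonoid (i : ι) : AddSubmonoid H :=
  AddSubmonoid.closure (Set.range w ∪ Set.range fun j ↦ z j - z i)

theorem mem_fractionMonoid (i : ι) (s : S) : w s ∈ fractionMonoid w z i :=
  AddSubmonoid.subset_closure (Or.inl ⟨s, rfl⟩)

theorem sub_mem_fractionMonoid (i j : ι) : z j - z i ∈ fractionMonoid w z i :=
  AddSubmonoid.subset_closure (Or.inr ⟨j, rfl⟩)

theorem fractionMonoid_le_iff (i : ι) (M : AddSubmonoid H) :
    fractionMonoid w z i ≤ M ↔ (∀ s, w s ∈ M) ∧ ∀ j, z j - z i ∈ M := by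
  rw [fractionMonoid, AddSubmonoid.closure_le, Set.union_subset_iff, Set.range_subset_iff,
    Set.range_subset_iff]
  rfl

/-- Once `z j - z i` is invertible, differences taken relative to `z i` and to `z j` generate the
same monoid. By symmetry this inclusion is an equality, which yields a common face of the two cones.
-/
theorem fractionMonoid_sup_le (i j : ι) :
    fractionMonoid w z i ⊔ AddSubmonoid.multiples (-(z j - z i)) ≤
      fractionMonoid w z j ⊔ AddSubmonoid.multiples (-(z i - z j)) := by
  have h1 : z j - z i ∈ fractionMonoid w z j ⊔ AddSubmonoid.multiples (-(z i - z j)) :=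
    AddSubmonoid.mem_sup_right (by
      rw [neg_sub]
      exact AddSubmonoid.mem_multiples _)
  refine sup_le ((fractionMonoid_le_iff w z i _).mpr
    ⟨fun s ↦ AddSubmonoid.mem_sup_left (mem_fractionMonoid w z j s), fun l ↦ ?_⟩) ?_
  · have h2 := add_mem (AddSubmonoid.mem_sup_left (sub_mem_fractionMonoid w z j l)) h1
    rwa [sub_add_sub_cancel] at h2
  · rw [AddSubmonoid.multiples_le, neg_sub (z j)]
    exact AddSubmonoid.mem_sup_left (sub_mem_fractionMonoid w z j i)

theorem isFaceOf_fractionMonoid (i j : ι) :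
    IsFaceOf (fractionMonoid w z j ⊔ AddSubmonoid.multiples (-(z i - z j)))
      (fractionMonoid w z i) :=
  ⟨z j - z i, sub_mem_fractionMonoid w z i j,
    le_antisymm (fractionMonoid_sup_le w z j i) (fractionMonoid_sup_le w z i j)⟩

variable (R : Type u) [CommRing R]

theorem isUnit_single {M : AddSubmonoid H} {h : H} (h1 : h ∈ M) (h2 : -h ∈ M) :
    IsUnit (AddMonoidAlgebra.single (⟨h, h1⟩ : M) (1 : R)) := by
  refine IsUnit.of_mul_eq_one (AddMonoidAlgebra.single (⟨-h, h2⟩ : M) (1 : R)) ?_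
  rw [AddMonoidAlgebra.single_mul_single, AddMonoidAlgebra.one_def]
  congr 1
  · ext; simp
  · simp

/-- The homogeneous coordinates on the part of the chart of `M` where that of weight `z i` is
invertible, normalized such that the latter is one. -/
def coordinateEval {i : ι} {M : AddSubmonoid H} (h : fractionMonoid w z i ≤ M) :
    MvPolynomial ι (ULift.{u} ℤ) →+* AddMonoidAlgebra R M :=
  MvPolynomial.eval₂Hom ((Int.castRingHom _).comp ULift.ringEquiv.toRingHom)
    (fun j ↦ AddMonoidAlgebra.single (⟨z j - z i, h (sub_mem_fractionMonoid w z i j)⟩ : M) (1 : R))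

theorem coordinateEval_X {i : ι} {M : AddSubmonoid H} (h : fractionMonoid w z i ≤ M) (j : ι) :
    coordinateEval w z R h (MvPolynomial.X j) = AddMonoidAlgebra.single
      (⟨z j - z i, h (sub_mem_fractionMonoid w z i j)⟩ : M) (1 : R) := by
  simp [coordinateEval]

theorem coordinateEval_X_self {i : ι} {M : AddSubmonoid H} (h : fractionMonoid w z i ≤ M) :
    coordinateEval w z R h (MvPolynomial.X i) = 1 := by
  rw [coordinateEval_X, AddMonoidAlgebra.one_def]
  congr 1
  ext
  simp

theorem isUnit_coordinateEval_X {i j : ι} {M : AddSubmonoid H} (h : fractionMonoid w z i ≤ M)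
    (h' : fractionMonoid w z j ≤ M) :
    IsUnit (coordinateEval w z R h (MvPolynomial.X j)) := by
  rw [coordinateEval_X]
  refine isUnit_single R _ ?_
  rw [neg_sub]
  exact h' (sub_mem_fractionMonoid w z j i)

theorem monoidRingMap_comp_coordinateEval {i : ι} {M M' : AddSubmonoid H}
    (h : fractionMonoid w z i ≤ M) (h' : M ≤ M') :
    (monoidRingMap R h').comp (coordinateEval w z R h) = coordinateEval w z R (h.trans h') := by
  apply MvPolynomial.ringHom_ext
  · intro r
    simp [coordinateEval]
  · intro j
    rw [RingHom.comp_apply, coordinateEval_X, coordinateEval_X, monoidRingMap_single]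
    rfl

instance gradedAlgebraMvPolynomialHomogeneous :
    GradedAlgebra (MvPolynomial.homogeneousSubmodule ι (ULift.{u} ℤ)) :=
  MvPolynomial.gradedAlgebra

theorem X_mem_homogeneousSubmodule (i : ι) :
    MvPolynomial.X i ∈ MvPolynomial.homogeneousSubmodule ι (ULift.{u} ℤ) 1 :=
  MvPolynomial.isHomogeneous_X _ i

/-- The morphism from the chart of `M` to projective space that is given by the homogeneous
coordinates. -/
def chartToProj {i : ι} {M : AddSubmonoid H} (h : fractionMonoid w z i ≤ M) :
    Spec (.of (AddMonoidAlgebra R M)) ⟶ Proj (MvPolynomial.homogeneousSubmodule ι (ULift.{u} ℤ)) :=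
  specToProj _ (coordinateEval w z R h) (X_mem_homogeneousSubmodule i) one_pos
    (isUnit_coordinateEval_X w z R h h)

/-- The two normalizations of the coordinates differ by the monomial of weight `z i - z j`, and
rescaling does not change the point of projective space. -/
theorem chartToProj_congr {i j : ι} {M : AddSubmonoid H} (hi : fractionMonoid w z i ≤ M)
    (hj : fractionMonoid w z j ≤ M) : chartToProj w z R hi = chartToProj w z R hj := by
  refine (specToProj_congr _ (coordinateEval w z R hi) _ _ _
    (X_mem_homogeneousSubmodule j) one_pos (isUnit_coordinateEval_X w z R hi hj)).trans ?_
  refine specToProj_eq_of_forall_eq_pow_mul _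
    (c := AddMonoidAlgebra.single (⟨z i - z j, hj (sub_mem_fractionMonoid w z j i)⟩ : M) (1 : R))
    (fun n p hp ↦ ?_) _ _ _ _
  rw [coordinateEval, coordinateEval, ← eval₂Hom_mul_of_isHomogeneous _ _ _ hp]
  congr 2
  funext l
  rw [AddMonoidAlgebra.single_mul_single, one_mul]
  congr 1
  ext
  simp

theorem SpecMap_monoidRingMap_comp_chartToProj {i : ι} {M M' : AddSubmonoid H}
    (h : fractionMonoid w z i ≤ M) (h' : M ≤ M') :
    Spec.map (CommRingCat.ofHom (monoidRingMap R h')) ≫ chartToProj w z R h =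
      chartToProj w z R (h.trans h') := by
  have h1 := monoidRingMap_comp_coordinateEval w z R h h'
  refine (SpecMap_comp_specToProj _ _ _ _ _ _ (by
    rw [h1]
    exact isUnit_coordinateEval_X w z R _ (h.trans h'))).trans ?_
  simp only [h1, chartToProj]

theorem chartToProj_preimage_basicOpen {i : ι} {M : AddSubmonoid H}
    (h : fractionMonoid w z i ≤ M) (j : ι) :
    chartToProj w z R h ⁻¹ᵁ Proj.basicOpen _ (MvPolynomial.X j) =
      PrimeSpectrum.basicOpen (AddMonoidAlgebra.single
        (⟨z j - z i, h (sub_mem_fractionMonoid w z i j)⟩ : M) (1 : R)) := by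
  rw [chartToProj, specToProj_preimage_basicOpen _ _ _ _ _
    (X_mem_homogeneousSubmodule j) one_pos, coordinateEval_X]

/-! ### Gluing the chart morphisms into a morphism to projective space -/

variable {w z} {C : Set (AddSubmonoid H)}

/-- The inclusion of the chart of a face into the toric scheme. -/
def toricChart (τ : ConeFaces C) : Spec (.of (AddMonoidAlgebra R τ.monoid)) ⟶ toricScheme R C :=
  colimit.ι (toricDiagram R C) τ

instance (τ : ConeFaces C) : IsOpenImmersion (toricChart R τ) :=
  inferInstanceAs (IsOpenImmersion (colimit.ι (toricDiagram R C) τ))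

theorem SpecMap_monoidRingMap_comp_toricChart {σ τ : ConeFaces C} (h : σ ≤ τ) :
    Spec.map (CommRingCat.ofHom (monoidRingMap R (IsFaceOf.le h))) ≫ toricChart R τ =
      toricChart R σ :=
  colimit.w (toricDiagram R C) (homOfLE h)

theorem toricChart_SpecMap_monoidRingMap_apply {σ τ : ConeFaces C} (h : σ ≤ τ)
    (y : Spec (.of (AddMonoidAlgebra R σ.monoid))) :
    toricChart R τ (Spec.map (CommRingCat.ofHom (monoidRingMap R (IsFaceOf.le h))) y) =
      toricChart R σ y := by
  rw [← SpecMap_monoidRingMap_comp_toricChart R h, Scheme.Hom.comp_apply]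

theorem exists_toricChart_eq (x : toricScheme R C) :
    ∃ (τ : ConeFaces C) (y : Spec (.of (AddMonoidAlgebra R τ.monoid))), toricChart R τ y = x :=
  Scheme.IsLocallyDirected.ι_jointly_surjective (toricDiagram R C) x

theorem toricScheme_hom_ext {X : Scheme.{u}} {f g : toricScheme R C ⟶ X}
    (h : ∀ τ, toricChart R τ ≫ f = toricChart R τ ≫ g) : f = g :=
  colimit.hom_ext h

variable (hC : ∀ M ∈ C, ∃ i, IsFaceOf M (fractionMonoid w z i))

include hC in
theorem ConeFaces.exists_isFaceOf (τ : ConeFaces C) :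
    ∃ i, IsFaceOf τ.monoid (fractionMonoid w z i) := by
  obtain ⟨M, hM, h⟩ := τ.isFace
  obtain ⟨i, hi⟩ := hC M hM
  exact ⟨i, h.trans hi⟩

/-- The morphism from the toric scheme to projective space given by the homogeneous coordinates. -/
def toricToProj :
    toricScheme R C ⟶ Proj (MvPolynomial.homogeneousSubmodule ι (ULift.{u} ℤ)) :=
  colimit.desc (toricDiagram R C)
    { pt := Proj (MvPolynomial.homogeneousSubmodule ι (ULift.{u} ℤ))
      ι :=
        { app := fun τ ↦ chartToProj w z R (τ.exists_isFaceOf hC).choose_spec.le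
          naturality := fun {σ τ} f ↦ by
            simp only [Functor.const_obj_obj, Functor.const_obj_map]
            refine (SpecMap_monoidRingMap_comp_chartToProj w z R _ (leOfHom f).le).trans ?_
            exact (chartToProj_congr w z R _ _).trans (Category.comp_id _).symm } }

theorem toricChart_toricToProj (τ : ConeFaces C) {i : ι} (hi : fractionMonoid w z i ≤ τ.monoid) :
    toricChart R τ ≫ toricToProj R hC = chartToProj w z R hi :=
  (colimit.ι_desc _ _).trans (chartToProj_congr w z R _ _)

/-- The cone of `fractionMonoid w z i`, as one of its own faces. -/
def coordinateCone (hι : ∀ i, fractionMonoid w z i ∈ C) (i : ι) : ConeFaces C :=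
  ⟨fractionMonoid w z i, _, hι i, .rfl' _⟩

theorem toricChart_preimage_preimage_basicOpen (hι : ∀ i, fractionMonoid w z i ∈ C) (i j : ι) :
    toricChart R (coordinateCone hι j) ⁻¹ᵁ toricToProj R hC ⁻¹ᵁ
        Proj.basicOpen _ (MvPolynomial.X i) =
      PrimeSpectrum.basicOpen (AddMonoidAlgebra.single
        (⟨z i - z j, sub_mem_fractionMonoid w z j i⟩ : fractionMonoid w z j) (1 : R)) := by
  rw [← Scheme.Hom.comp_preimage, toricChart_toricToProj R hC (coordinateCone hι j) le_rfl]
  exact chartToProj_preimage_basicOpen w z R le_rfl i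

theorem toricToProj_preimage_basicOpen (hι : ∀ i, fractionMonoid w z i ∈ C) (i : ι) :
    toricToProj R hC ⁻¹ᵁ Proj.basicOpen _ (MvPolynomial.X i) =
      (toricChart R (coordinateCone hι i)).opensRange := by
  apply le_antisymm
  · intro x hx
    obtain ⟨τ, y, rfl⟩ := exists_toricChart_eq R x
    obtain ⟨j, hj⟩ := τ.exists_isFaceOf hC
    have hτ : τ ≤ coordinateCone hι j := hj
    rw [← toricChart_SpecMap_monoidRingMap_apply R hτ] at hx ⊢
    set y' := Spec.map (CommRingCat.ofHom (monoidRingMap R (IsFaceOf.le hτ))) y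
    -- The monomial of weight `z i - z j` is invertible at `y'`. Its nonvanishing locus is the chart
    -- of the face `l`, which is also a face of the cone of `i`.
    have hl : IsFaceOf (fractionMonoid w z j ⊔ AddSubmonoid.multiples (-(z i - z j)))
        (fractionMonoid w z j) := ⟨_, sub_mem_fractionMonoid w z j i, rfl⟩
    let l : ConeFaces C := ⟨_, _, hι j, hl⟩
    have hlj : l ≤ coordinateCone hι j := hl
    have hli : l ≤ coordinateCone hι i := isFaceOf_fractionMonoid w z i j
    have hy' : y' ∈ toricChart R (coordinateCone hι j) ⁻¹ᵁ toricToProj R hC ⁻¹ᵁ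
        Proj.basicOpen _ (MvPolynomial.X i) := hx
    rw [toricChart_preimage_preimage_basicOpen] at hy'
    obtain ⟨v, hv⟩ : y' ∈ Set.range ((toricDiagram R C).map (homOfLE hlj)) := by
      rw [range_toricDiagram_map R C (homOfLE hlj) (sub_mem_fractionMonoid w z j i) rfl]
      exact hy'
    refine ⟨Spec.map (CommRingCat.ofHom (monoidRingMap R (IsFaceOf.le hli))) v, ?_⟩
    rw [← hv]
    exact (toricChart_SpecMap_monoidRingMap_apply R hli v).trans
      (toricChart_SpecMap_monoidRingMap_apply R hlj v).symm
  · rintro _ ⟨y, rfl⟩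
    change y ∈ toricChart R (coordinateCone hι i) ⁻¹ᵁ toricToProj R hC ⁻¹ᵁ
      Proj.basicOpen _ (MvPolynomial.X i)
    have h := coordinateEval_X_self w z R (le_refl (fractionMonoid w z i))
    rw [coordinateEval_X] at h
    rw [toricChart_preimage_preimage_basicOpen, h, PrimeSpectrum.basicOpen_one]
    trivial

theorem toricChart_toricMonomialMap (hw : ∀ M ∈ C, ∀ s, w s ∈ M) (τ : ConeFaces C)
    (hτ : ∀ s, w s ∈ τ.monoid) :
    toricChart R τ ≫ toricMonomialMap R C w hw = Spec.map (CommRingCat.ofHom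
      (MvPolynomial.aeval (R := R) (fun s ↦ AddMonoidAlgebra.single
        (⟨w s, hτ s⟩ : τ.monoid) (1 : R))).toRingHom) :=
  colimit.ι_desc _ _

theorem toricChart_toricSchemeToBase (τ : ConeFaces C) :
    toricChart R τ ≫ toricSchemeToBase R C =
      Spec.map (CommRingCat.ofHom (algebraMap R (AddMonoidAlgebra R τ.monoid))) :=
  colimit.ι_desc _ _

/-- The monoid ring of `fractionMonoid w z i` is generated by the weights `w s` and `z j - z i`. -/
theorem mem_subring_of_forall_mem (i : ι)
    (T : Subring (CommRingCat.of (AddMonoidAlgebra R (fractionMonoid w z i))))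
    (hw : ∀ p, MvPolynomial.aeval (R := R) (fun s ↦ AddMonoidAlgebra.single
      (⟨w s, mem_fractionMonoid w z i s⟩ : fractionMonoid w z i) (1 : R)) p ∈ T)
    (hz : ∀ p, awayEval (MvPolynomial.homogeneousSubmodule ι (ULift.{u} ℤ))
      (coordinateEval w z R (le_refl (fractionMonoid w z i)))
      (isUnit_coordinateEval_X w z R le_rfl (le_refl (fractionMonoid w z i))) p ∈ T)
    (p : AddMonoidAlgebra R (fractionMonoid w z i)) : p ∈ T := by
  have hsingle : ∀ m (hm : m ∈ fractionMonoid w z i),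
      AddMonoidAlgebra.single (⟨m, hm⟩ : fractionMonoid w z i) (1 : R) ∈ T := by
    intro m hm
    induction hm using AddSubmonoid.closure_induction with
    | mem m hm =>
      rcases hm with ⟨s, rfl⟩ | ⟨j, rfl⟩
      · have h := hw (MvPolynomial.X s)
        rwa [MvPolynomial.aeval_X] at h
      -- The fraction `X j / X i` maps to the monomial of weight `z j - z i`, since `X i` maps to
      -- one.
      · have h := awayEval_mk_mul (MvPolynomial.homogeneousSubmodule ι (ULift.{u} ℤ))
          (coordinateEval w z R (le_refl (fractionMonoid w z i)))
          (isUnit_coordinateEval_X w z R le_rfl (le_refl (fractionMonoid w z i)))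
          (X_mem_homogeneousSubmodule i) 1 (MvPolynomial.X j)
          (X_mem_homogeneousSubmodule j)
        rw [coordinateEval_X_self, one_pow, mul_one, coordinateEval_X] at h
        exact h ▸ hz _
    | zero => exact T.one_mem
    | add a b ha hb iha ihb =>
      have h : AddMonoidAlgebra.single (⟨a, ha⟩ : fractionMonoid w z i) (1 : R) *
          AddMonoidAlgebra.single (⟨b, hb⟩ : fractionMonoid w z i) (1 : R) ∈ T :=
        T.mul_mem iha ihb
      rwa [AddMonoidAlgebra.single_mul_single, one_mul] at h
  induction p using AddMonoidAlgebra.induction_linear with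
  | zero => exact T.zero_mem
  | add f g hf hg => exact T.add_mem hf hg
  | single m r =>
    -- The scalars of `R` come from the affine space, as the projective space is taken over the
    -- integers.
    have h := hw (MvPolynomial.C r)
    rw [← MvPolynomial.algebraMap_eq, AlgHom.commutes] at h
    have h' : algebraMap R _ r * AddMonoidAlgebra.single m (1 : R) ∈ T :=
      T.mul_mem h (hsingle m.1 m.2)
    simpa [AddMonoidAlgebra.coe_algebraMap, AddMonoidAlgebra.single_mul_single] using h'

end ToricProj

/-! ### Projectivity and separatedness from homogeneous coordinates -/

section Projective

variable {H : Type} [AddCommGroup H] {S : Type} {w : S → H} {N : ℕ} {z : Fin (N + 1) → H}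
  {C : Set (AddSubmonoid H)} (R : Type u) [CommRing R]

theorem isProjectiveMorphism_toricMonomialMap (hw : ∀ M ∈ C, ∀ s, w s ∈ M)
    (hC : ∀ M ∈ C, ∃ i, IsFaceOf M (fractionMonoid w z i)) (hι : ∀ i, fractionMonoid w z i ∈ C) :
    IsProjectiveMorphism (toricMonomialMap R C w hw) := by
  let 𝒜 := MvPolynomial.homogeneousSubmodule (Fin (N + 1)) (ULift.{u} ℤ)
  let a : Spec (.of (MvPolynomial S R)) ⟶ ⊤_ Scheme.{u} := terminal.from _
  let b : Proj 𝒜 ⟶ ⊤_ Scheme.{u} := terminal.from _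
  let f : toricScheme R C ⟶ pullback a b :=
    pullback.lift (toricMonomialMap R C w hw) (toricToProj R hC) (terminal.hom_ext _ _)
  refine ⟨N, f, ?_, pullback.lift_fst _ _ _⟩
  let awayι (i : Fin (N + 1)) := Proj.awayι 𝒜 (MvPolynomial.X i)
    (X_mem_homogeneousSubmodule i) one_pos
  have hcomm (i : Fin (N + 1)) : (toricChart R (coordinateCone hι i) ≫ f) ≫ pullback.snd a b =
      Spec.map (CommRingCat.ofHom (awayEval 𝒜
        (coordinateEval w z R (le_refl (fractionMonoid w z i)))
        (isUnit_coordinateEval_X w z R le_rfl (le_refl (fractionMonoid w z i))))) ≫ awayι i := by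
    rw [Category.assoc, pullback.lift_snd]
    exact toricChart_toricToProj R hC (coordinateCone hι i) le_rfl
  let iV (i : Fin (N + 1)) : pullback (pullback.snd a b) (awayι i) ⟶ pullback a b :=
    pullback.fst _ _
  have (i : Fin (N + 1)) : IsOpenImmersion (awayι i) :=
    inferInstanceAs (IsOpenImmersion (Proj.awayι ..))
  have (i : Fin (N + 1)) : IsOpenImmersion (iV i) :=
    inferInstanceAs (IsOpenImmersion (pullback.fst _ _))
  have hiV (i : Fin (N + 1)) :
      (iV i).opensRange = pullback.snd a b ⁻¹ᵁ Proj.basicOpen 𝒜 (MvPolynomial.X i) := by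
    rw [← Proj.opensRange_awayι 𝒜 (MvPolynomial.X i)
      (X_mem_homogeneousSubmodule i) one_pos]
    exact TopologicalSpace.Opens.ext (IsOpenImmersion.range_pullbackFst _ _)
  refine isClosedImmersion_of_forall_isClosedImmersion f
    (fun i ↦ toricChart R (coordinateCone hι i)) iV (fun i ↦ pullback.lift _ _ (hcomm i))
    (fun i ↦ (pullback.lift_fst _ _ _).symm) (fun i ↦ ?_) ?_ (fun i ↦ ?_)
  · rw [hiV, ← toricToProj_preimage_basicOpen R hC hι i, ← Scheme.Hom.comp_preimage,
      pullback.lift_snd]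
  · simp only [hiV]
    rw [← Scheme.Hom.preimage_iSup, iSup_basicOpen_X_eq_top]
    rfl
  -- This is the product of the affine space with the affine chart `X i ≠ 0` of projective space.
  · have : IsAffine (pullback (pullback.snd a b) (awayι i)) :=
      .of_isIso (pullbackLeftPullbackSndIso a b (awayι i)).hom
    have hfst : (toricChart R (coordinateCone hι i) ≫ f) ≫ pullback.fst a b =
        Spec.map (CommRingCat.ofHom (MvPolynomial.aeval (R := R)
          (fun s ↦ AddMonoidAlgebra.single
            (⟨w s, mem_fractionMonoid w z i s⟩ : fractionMonoid w z i) (1 : R))).toRingHom) := by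
      rw [Category.assoc, pullback.lift_fst]
      exact toricChart_toricMonomialMap R hw _ _
    exact isClosedImmersion_spec_of_surjective_on_pair (iV i ≫ pullback.fst a b)
      (pullback.snd _ _) _ ((Category.assoc _ _ _).symm.trans
        ((congrArg (· ≫ _) (pullback.lift_fst _ _ (hcomm i))).trans hfst))
      (pullback.lift_snd _ _ (hcomm i)) (mem_subring_of_forall_mem R i)

theorem toricMonomialMap_comp_toBase (hw : ∀ M ∈ C, ∀ s, w s ∈ M) :
    toricMonomialMap R C w hw ≫
      Spec.map (CommRingCat.ofHom (algebraMap R (MvPolynomial S R))) = toricSchemeToBase R C := by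
  refine toricScheme_hom_ext R fun τ ↦ ?_
  obtain ⟨M, hM, h⟩ := τ.isFace
  rw [← Category.assoc, toricChart_toricMonomialMap R hw τ fun s ↦ h.le (hw M hM s),
    toricChart_toricSchemeToBase, ← Spec.map_comp, ← CommRingCat.ofHom_comp]
  congr 2
  exact RingHom.ext fun r ↦ AlgHom.commutes (MvPolynomial.aeval _) r

/-- The structure morphism is a closed immersion followed by the projections of projective space and
of affine space, all of which are separated. -/
theorem isSeparated_toricSchemeToBase (hw : ∀ M ∈ C, ∀ s, w s ∈ M)
    (h : IsProjectiveMorphism (toricMonomialMap R C w hw)) :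
    IsSeparated (toricSchemeToBase R C) := by
  obtain ⟨N, i, hi, h⟩ := h
  rw [← toricMonomialMap_comp_toBase R hw, ← h]
  infer_instance

end Projective

/-! ### Homogeneous coordinates for `Y_{n,k}` -/

section Coordinates

variable {n k : ℕ}

theorem mk_eq_sum (f : Fin (n + 1) → ℤ) (g : Fin k → ℤ) :
    (QuotientAddGroup.mk (f, g) : PuncturedLattice n k) =
      ∑ i, f i • xClass n k i + ∑ j, g j • vClass n k j := by
  let q := QuotientAddGroup.mk' (AddSubgroup.zmultiples
    ((fun _ ↦ 1, fun _ ↦ -1) : (Fin (n + 1) → ℤ) × (Fin k → ℤ)))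
  have h : (f, g) = ∑ i : Fin (n + 1), f i • (Pi.single i 1, 0) +
      ∑ j : Fin k, g j • ((0, Pi.single j 1) : (Fin (n + 1) → ℤ) × (Fin k → ℤ)) := by
    ext m <;> simp [Prod.fst_sum, Prod.snd_sum, Finset.sum_apply, Pi.single_apply]
  change q (f, g) = _
  rw [h]
  simp only [map_add, map_sum, map_zsmul]
  rfl

theorem zsmul_mem_of_neg_mem {H : Type*} [AddCommGroup H] {M : AddSubmonoid H} {h : H} (h1 : h ∈ M)
    (h2 : -h ∈ M) (m : ℤ) : m • h ∈ M := by
  rcases m with m | m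
  · simpa using M.nsmul_mem h1 m
  · simpa [negSucc_zsmul] using M.nsmul_mem h2 (m + 1)

/-- Inverting the sum inverts every summand, as the other summands lie in `M`, and the weights
generate the lattice as a group. -/
theorem sup_multiples_neg_sum_yWeights {M : AddSubmonoid (PuncturedLattice n k)}
    (hM : ∀ s, yWeights n k s ∈ M) : M ⊔ AddSubmonoid.multiples (-∑ s, yWeights n k s) = ⊤ := by
  set M' := M ⊔ AddSubmonoid.multiples (-∑ s, yWeights n k s)
  have h1 (s) : yWeights n k s ∈ M' := AddSubmonoid.mem_sup_left (hM s)
  have h2 (s) : -yWeights n k s ∈ M' := by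
    have h3 : -∑ s, yWeights n k s ∈ M' :=
      AddSubmonoid.mem_sup_right (AddSubmonoid.mem_multiples _)
    have h4 := add_mem h3 (sum_mem (t := Finset.univ.erase s) fun s' _ ↦ h1 s')
    rwa [← Finset.add_sum_erase _ _ (Finset.mem_univ s), neg_add, neg_add_cancel_right] at h4
  rw [eq_top_iff]
  rintro h -
  obtain ⟨⟨f, g⟩, rfl⟩ := QuotientAddGroup.mk_surjective h
  rw [mk_eq_sum]
  exact add_mem
    (sum_mem fun i _ ↦ zsmul_mem_of_neg_mem (h1 (Sum.inr i)) (h2 (Sum.inr i)) _)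
    (sum_mem fun j _ ↦ zsmul_mem_of_neg_mem (h1 (Sum.inl j)) (h2 (Sum.inl j)) _)

theorem isFaceOf_top {M : AddSubmonoid (PuncturedLattice n k)} (hM : ∀ s, yWeights n k s ∈ M) :
    IsFaceOf ⊤ M :=
  ⟨∑ s, yWeights n k s, sum_mem fun s _ ↦ hM s, (sup_multiples_neg_sum_yWeights hM).symm⟩

variable (n k) in
/-- The sum of the classes `c_{il}` for `m ≤ l < k`. -/
def cSum (i m : ℕ) : PuncturedLattice n k :=
  ∑ l ∈ Finset.Ico m k, cClass n k i l

theorem cSum_sub_cSum (i : ℕ) {m m' : ℕ} (h : m ≤ m') (h' : m' ≤ k) :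
    cSum n k i m - cSum n k i m' = ∑ l ∈ Finset.Ico m m', cClass n k i l := by
  rw [cSum, cSum, sub_eq_iff_eq_add, Finset.sum_Ico_consecutive _ h h']

theorem cSum_sub_cSum_succ (i : ℕ) {m : ℕ} (h : m < k) :
    cSum n k i m - cSum n k i (m + 1) = cClass n k i m := by
  rw [cSum_sub_cSum i m.le_succ h]
  simp

/-- The weight of the homogeneous coordinate that generates on the chart of `φ`: the sum of the
`c_{il}` for `l ≥ φ(i)`, which are those that are nonpositive on the cone of `φ`. -/
def coordinateWeight (φ : Fin n → Fin k) : PuncturedLattice n k :=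
  ∑ a, cSum n k (a.val + 1) ((φ a).val + 1)

/-- The difference is a sum of classes `c_{il}` with `l < φ(i)`, or of classes `-c_{il}` with `l ≥
φ(i)`. Each differs from `c_{i,φ(i)-1}` or `-c_{i,φ(i)}` by a sum of `v`'s. -/
theorem cSum_sub_cSum_mem (φ : Fin n → Fin k) (hφ : Antitone φ) (a : Fin n) (m : ℕ) (hm : m ≤ k) :
    cSum n k (a.val + 1) m - cSum n k (a.val + 1) ((φ a).val + 1) ∈ chartMonoid n k φ := by
  have hk := (φ a).isLt
  rcases le_total m ((φ a).val + 1) with h | h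
  · rw [cSum_sub_cSum _ h hk]
    refine sum_mem fun l hl ↦ ?_
    rw [Finset.mem_Ico] at hl
    have := add_mem (cClass_sub_mem φ hφ (a.val + 1) l (φ a) (by omega) hk.le)
      (cClass_mem φ hφ (n - 1 - a) a a.isLt (by omega))
    simpa using this
  · rw [← neg_sub, cSum_sub_cSum _ h hm, ← Finset.sum_neg_distrib]
    refine sum_mem fun l hl ↦ ?_
    rw [Finset.mem_Ico] at hl
    have := add_mem (cClass_sub_mem φ hφ (a.val + 1) ((φ a).val + 1) l (by omega) (by omega))
      (neg_cClass_mem φ hφ a a.isLt)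
    simpa [sub_eq_add_neg, add_comm, add_left_comm] using this

theorem coordinateWeight_sub_mem (φ ψ : Fin n → Fin k) (hφ : Antitone φ) :
    coordinateWeight ψ - coordinateWeight φ ∈ chartMonoid n k φ := by
  rw [coordinateWeight, coordinateWeight, ← Finset.sum_sub_distrib]
  exact sum_mem fun a _ ↦ cSum_sub_cSum_mem φ hφ a _ (ψ a).isLt

/-- If `j` is adjacent to `φ a`, a single class remains, which is a candidate for a generator in
`S_φ`. -/
theorem coordinateWeight_update_sub (φ : Fin n → Fin k) (a : Fin n) (j : Fin k) :
    coordinateWeight (Function.update φ a j) - coordinateWeight φ =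
      cSum n k (a.val + 1) (j.val + 1) - cSum n k (a.val + 1) ((φ a).val + 1) := by
  rw [coordinateWeight, coordinateWeight, ← Finset.sum_sub_distrib, Finset.sum_eq_single a]
  · rw [Function.update_self]
  · intro b _ hb
    rw [Function.update_of_ne hb, sub_self]
  · simp

theorem antitone_update {α β : Type*} [LinearOrder α] [Preorder β] {φ : α → β} (hφ : Antitone φ)
    {a : α} {j : β} (h1 : ∀ b < a, j ≤ φ b) (h2 : ∀ b > a, φ b ≤ j) :
    Antitone (Function.update φ a j) := by
  intro b c hbc
  rcases eq_or_ne b a with hb | hb <;> rcases eq_or_ne c a with hc | hc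
  · rw [hb, hc]
  · subst hb
    simpa [hc] using h2 c (lt_of_le_of_ne hbc hc.symm)
  · subst hc
    simpa [hb] using h1 b (lt_of_le_of_ne hbc hb)
  · simpa [hb, hc] using hφ hbc

/-- This replaces the move that raises `φ a` when `φ a` is already maximal. -/
theorem cClass_right_eq_neg_sum (i : ℕ) :
    -cClass n k i k = ∑ m : Fin (n + 1) with m.val < i, xClass n k m := by
  have : (Finset.univ.filter fun l : Fin k ↦ k ≤ l.val) = ∅ := by
    ext m
    simp
  simp [cClass, this]

/-- The relation of the lattice leaves the remaining `x`'s. This replaces the move that lowers `φ a`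
when `φ a` is already minimal. -/
theorem cClass_right_zero_eq_sum (i : ℕ) :
    cClass n k i 0 = ∑ m : Fin (n + 1) with ¬ m.val < i, xClass n k m := by
  simp only [cClass, Nat.zero_le, Finset.filter_true]
  rw [← sum_xClass_eq_sum_vClass, sub_eq_iff_eq_add', Finset.sum_filter_add_sum_filter_not]

theorem fractionMonoid_eq_chartMonoid {ι : Type} (e : ι ≃ {φ : Fin n → Fin k // Antitone φ})
    (i : ι) : fractionMonoid (yWeights n k) (fun i ↦ coordinateWeight (e i).1) i =
      chartMonoid n k (e i).1 := by
  obtain ⟨φ, hφ, he⟩ : ∃ φ, ∃ hφ : Antitone φ, e i = ⟨φ, hφ⟩ := ⟨_, (e i).2, rfl⟩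
  set z := fun i ↦ coordinateWeight (e i).1 with hz
  set M := fractionMonoid (yWeights n k) z i
  have hzi : z i = coordinateWeight φ := by rw [hz]; simp [he]
  rw [he]
  apply le_antisymm
  · rw [fractionMonoid_le_iff]
    refine ⟨fun s ↦ yWeights_mem _ (Or.inr ⟨φ, hφ, rfl⟩) s, fun j ↦ ?_⟩
    rw [hzi]
    exact coordinateWeight_sub_mem φ _ hφ
  have hv (j) : vClass n k j ∈ M := mem_fractionMonoid _ z i (Sum.inl j)
  have hx (m) : xClass n k m ∈ M := mem_fractionMonoid _ z i (Sum.inr m)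
  have hψ (a : Fin n) (j : Fin k) (h : Antitone (Function.update φ a j)) :
      cSum n k (a.val + 1) (j.val + 1) - cSum n k (a.val + 1) ((φ a).val + 1) ∈ M := by
    have hzj : z (e.symm ⟨_, h⟩) = coordinateWeight (Function.update φ a j) := by
      rw [hz]
      simp
    have := sub_mem_fractionMonoid (yWeights n k) z i (e.symm ⟨_, h⟩)
    rwa [hzi, hzj, coordinateWeight_update_sub] at this
  rw [chartMonoid, AddSubmonoid.closure_le]
  rintro h (((⟨j, -, rfl⟩ | ⟨a, b, -, -, rfl⟩) | ⟨a, ha, rfl⟩) | ⟨a, ha, rfl⟩)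
  · exact hv j
  · exact hx _
  · rcases (show (φ a).val + 1 ≤ k from (φ a).isLt).eq_or_lt with hk | hk
    · rw [hk, cClass_right_eq_neg_sum]
      exact sum_mem fun m _ ↦ hx m
    -- Raising `φ a` by one keeps `φ` nonincreasing because `ha` makes the preceding value strictly
    -- larger.
    · have := hψ a ⟨_, hk⟩ (antitone_update hφ (fun b hb ↦ ?_)
        fun b hb ↦ (hφ hb.le).trans (Nat.le_succ _))
      · rwa [← neg_sub, cSum_sub_cSum_succ _ hk] at this
      · have hb' : b.val < a.val := hb
        have h1 := ha ⟨a.val - 1, by omega⟩ (by simp; omega)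
        have h2 : φ ⟨a.val - 1, by omega⟩ ≤ φ b := hφ (by rw [Fin.le_def]; simp; omega)
        exact Nat.succ_le_of_lt (h1.trans_le h2)
  · rcases Nat.eq_zero_or_pos (φ a).val with h0 | h0
    · rw [h0, cClass_right_zero_eq_sum]
      exact sum_mem fun m _ ↦ hx m
    · have hk := (φ a).isLt
      -- Lowering `φ a` by one keeps `φ` nonincreasing because `ha` makes the following value
      -- strictly smaller.
      have := hψ a ⟨(φ a).val - 1, by omega⟩ (antitone_update hφ
        (fun b hb ↦ le_trans (Nat.sub_le _ _) (hφ hb.le)) fun b hb ↦ ?_)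
      · rwa [Nat.sub_add_cancel h0, cSum_sub_cSum_succ _ hk] at this
      · have hb' : a.val < b.val := hb
        have h1 : (φ ⟨a.val + 1, by omega⟩).val < (φ a).val := ha ⟨a.val + 1, by omega⟩ rfl
        have h2 : φ b ≤ φ ⟨a.val + 1, by omega⟩ := hφ (by rw [Fin.le_def]; exact hb')
        rw [Fin.le_def] at h2 ⊢
        simp only
        omega

variable (n k) in
/-- There are homogeneous coordinates whose standard affine charts are those of `Y_{n,k}`. -/
theorem exists_fractionMonoid_mem_yCones :
    ∃ (N : ℕ) (z : Fin (N + 1) → PuncturedLattice n k),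
      (∀ M ∈ yCones n k, ∃ i, IsFaceOf M (fractionMonoid (yWeights n k) z i)) ∧
        ∀ i, fractionMonoid (yWeights n k) z i ∈ yCones n k := by
  rcases isEmpty_or_nonempty {φ : Fin n → Fin k // Antitone φ} with hI | hI
  · obtain rfl : k = 0 := by
      by_contra hk
      exact hI.false ⟨fun _ ↦ ⟨0, Nat.pos_of_ne_zero hk⟩, fun _ _ _ ↦ le_rfl⟩
    -- Without any `φ` only the torus is left, and one coordinate suffices: for `k = 0` the weights
    -- sum to zero, hence are already invertible.
    have h (i : Fin 1) : fractionMonoid (yWeights n 0) (fun _ ↦ 0) i = ⊤ := by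
      rw [← sup_multiples_neg_sum_yWeights
        fun s ↦ mem_fractionMonoid (yWeights n 0) (fun _ ↦ 0) i s]
      simp [yWeights, Fintype.sum_sum_type, sum_xClass_eq_sum_vClass]
    refine ⟨0, fun _ ↦ 0, ?_, fun i ↦ Or.inl (h i)⟩
    rintro M (rfl | ⟨φ, hφ, -⟩)
    · exact ⟨0, h 0 ▸ .rfl' _⟩
    · exact (hI.false ⟨φ, hφ⟩).elim
  · have := Fintype.ofFinite {φ : Fin n → Fin k // Antitone φ}
    obtain ⟨N, hN⟩ := Nat.exists_eq_succ_of_ne_zero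
      (Fintype.card_ne_zero (α := {φ : Fin n → Fin k // Antitone φ}))
    let e := (Fintype.equivFinOfCardEq hN).symm
    refine ⟨N, fun i ↦ coordinateWeight (e i).1, ?_, fun i ↦
      Or.inr ⟨_, (e i).2, fractionMonoid_eq_chartMonoid e i⟩⟩
    rintro M (rfl | ⟨φ, hφ, rfl⟩)
    · exact ⟨0, isFaceOf_top fun s ↦ mem_fractionMonoid _ _ 0 s⟩
    · refine ⟨e.symm ⟨φ, hφ⟩, ?_⟩
      rw [fractionMonoid_eq_chartMonoid, Equiv.apply_symm_apply]
      exact .rfl' _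

end Coordinates

end

theorem corollary3 {R : Type u} [CommRing R] (n k : ℕ) :
    IsProjectiveMorphism (toricYToAffineSpace R n k) ∧ IsSeparated (toricYToBase R n k) := by
  obtain ⟨N, z, hC, hι⟩ := exists_fractionMonoid_mem_yCones n k
  have h := isProjectiveMorphism_toricMonomialMap R (w := yWeights n k) yWeights_mem hC hι
  exact ⟨h, isSeparated_toricSchemeToBase R yWeights_mem h⟩
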